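/- Let $D=\{z\in\mathbb C:|z|<1\}$ and let $0<p\le 1$. Let $C^\infty(\partial D)$ be the space of smooth $2\pi$-periodic functions $\varphi:\mathbb R\to\mathbb C$ with the topology of uniform convergence of all derivatives, and let $\mathcal D'(\partial D)$ be the space of distributions on $\partial D$, i.e. of continuous linear functionals on $C^\infty(\partial D)$. The holomorphic Hardy space $H^p(D)$ consists of the holomorphic functions $w:D\to\mathbb C$ with \[ \|w\|_{H^p(D)}=\left(\sup_{0<r<1}\frac1{2\pi}\int_0^{2\pi}|w(re^{i\theta})|^p\,d\theta\right)^{1/p}<\infty . \] A distribution $w_b\in\mathcal D'(\partial D)$ is the boundary value in the sense of distributions of $w$ if \[ \langle w_b,\varphi\rangle=\lim_{r\nearrow1}\int_0^{2\pi}w(re^{i\theta})\,\varphi(\theta)\,d\theta\qquad\text{for every }\varphi\in C^\infty(\partial D). \] The real part of a distribution $T$ is the distribution given by $\langle \operatorname{Re}T,\varphi\rangle=\frac12\bigl(\langle T,\varphi\rangle+\overline{\langle T,\overline\varphi\rangle}\bigr)$. Let $\operatorname{Re}(H^p(D))_b$ be the set of all distributions $\operatorname{Re}H_b$, where $H_b$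 is the boundary value in the sense of distributions of some $H\in H^p(D)$. The real-variable Hardy space $\mathcal H^p(D)$ is the set of distributions $g\in\mathcal D'(\partial D)$ such that \[ \int_0^{2\pi}\left(\sup_{0\le r<1}\left|\frac1{2\pi}\langle g,P_r(\theta-\cdot)\rangle\right|\right)^p d\theta<\infty,\qquad P_r(\theta)=\frac{1-r^2}{1-2r\cos\theta+r^2}. \] Then \[ \operatorname{Re}(H^p(D))_b\subseteq\mathcal H^p(D). \] -/

import Mathlib

open scoped ContDiff ENNReal Topology ComplexConjugate

noncomputable section

namespace CircleHardy

/-! ### Smooth functions and distributions on the unit circle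

A function on the circle is written as a `2π`-periodic function of the angle. -/

/-- The smooth `2π`-periodic functions `ℝ → ℂ`, as a submodule of all functions. -/
def smoothPeriodic : Submodule ℂ (ℝ → ℂ) where
  carrier := {φ | ContDiff ℝ ∞ φ ∧ Function.Periodic φ (2 * Real.pi)}
  add_mem' := fun h₁ h₂ => ⟨h₁.1.add h₂.1, h₁.2.add h₂.2⟩
  zero_mem' := ⟨contDiff_const, fun _ => rfl⟩
  smul_mem' := fun c _ h => ⟨contDiff_const.smul h.1, h.2.smul c⟩

/-- The space `C^∞(∂D)` of test functions. It is a separate type, so that it does not inherit the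
topology of pointwise convergence. -/
def TestFun : Type := smoothPeriodic

instance : AddCommGroup TestFun := inferInstanceAs (AddCommGroup smoothPeriodic)

instance : Module ℂ TestFun := inferInstanceAs (Module ℂ smoothPeriodic)

namespace TestFun

instance : FunLike TestFun ℝ ℂ where
  coe := fun φ => φ.1
  coe_injective := fun _ _ h => Subtype.ext h

@[ext]
theorem ext {φ ψ : TestFun} (h : ∀ θ, φ θ = ψ θ) : φ = ψ := DFunLike.ext φ ψ h

@[simp]
theorem add_apply (φ ψ : TestFun) (θ : ℝ) : (φ + ψ) θ = φ θ + ψ θ := rfl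

@[simp]
theorem sub_apply (φ ψ : TestFun) (θ : ℝ) : (φ - ψ) θ = φ θ - ψ θ := rfl

@[simp]
theorem smul_apply (c : ℂ) (φ : TestFun) (θ : ℝ) : (c • φ) θ = c * φ θ := rfl

/-- The test function with a given underlying smooth periodic function. -/
def mk (f : ℝ → ℂ) (h₁ : ContDiff ℝ ∞ f) (h₂ : Function.Periodic f (2 * Real.pi)) : TestFun :=
  ⟨f, h₁, h₂⟩

@[simp]
theorem mk_apply (f : ℝ → ℂ) (h₁ : ContDiff ℝ ∞ f) (h₂ : Function.Periodic f (2 * Real.pi))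
    (θ : ℝ) : mk f h₁ h₂ θ = f θ := rfl

theorem contDiff (φ : TestFun) : ContDiff ℝ ∞ φ := φ.2.1

theorem periodic (φ : TestFun) : Function.Periodic φ (2 * Real.pi) := φ.2.2

theorem continuous_iteratedDeriv (φ : TestFun) (k : ℕ) : Continuous (iteratedDeriv k φ) :=
  φ.contDiff.continuous_iteratedDeriv k (by exact_mod_cast le_top)

theorem periodic_iteratedDeriv (φ : TestFun) (k : ℕ) :
    Function.Periodic (iteratedDeriv k φ) (2 * Real.pi) := by
  intro x
  have h := congrFun (iteratedDeriv_comp_add_const k φ (2 * Real.pi)) x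
  have h' : (fun z => φ (z + 2 * Real.pi)) = φ := funext φ.periodic
  rw [h'] at h
  exact h.symm

theorem bddAbove_iteratedDeriv (φ : TestFun) (k : ℕ) :
    BddAbove (Set.range fun θ => ‖iteratedDeriv k φ θ‖) := by
  have h := (φ.periodic_iteratedDeriv k).isBounded_of_continuous Real.two_pi_pos.ne'
    (φ.continuous_iteratedDeriv k)
  obtain ⟨C, hC⟩ := h.exists_norm_le
  exact ⟨C, by rintro _ ⟨θ, rfl⟩; exact hC _ ⟨θ, rfl⟩⟩

/-- The seminorm `φ ↦ sup_θ |φ⁽ᵏ⁾(θ)|`. -/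
def supSeminorm (k : ℕ) : Seminorm ℂ TestFun :=
  Seminorm.of (fun φ => ⨆ θ : ℝ, ‖iteratedDeriv k φ θ‖)
    (by
      intro φ ψ
      refine ciSup_le fun θ => ?_
      have h : iteratedDeriv k (φ + ψ : TestFun) θ
          = iteratedDeriv k φ θ + iteratedDeriv k ψ θ :=
        iteratedDeriv_fun_add (n := k) (x := θ)
          (φ.contDiff.of_le (by exact_mod_cast le_top)).contDiffAt
          (ψ.contDiff.of_le (by exact_mod_cast le_top)).contDiffAt
      rw [h]
      exact (norm_add_le _ _).trans
        (add_le_add (le_ciSup (φ.bddAbove_iteratedDeriv k) θ)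
          (le_ciSup (ψ.bddAbove_iteratedDeriv k) θ)))
    (by
      intro c φ
      have h : ∀ θ, ‖iteratedDeriv k (c • φ : TestFun) θ‖ = ‖c‖ * ‖iteratedDeriv k φ θ‖ := by
        intro θ
        have h' : iteratedDeriv k (c • φ : TestFun) θ = c • iteratedDeriv k φ θ :=
          iteratedDeriv_fun_const_smul (φ.contDiff.of_le (by exact_mod_cast le_top)).contDiffAt c
        rw [h', norm_smul]
      simp_rw [h]
      exact (Real.mul_iSup_of_nonneg (norm_nonneg c) _).symm)

theorem supSeminorm_apply (k : ℕ) (φ : TestFun) :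
    supSeminorm k φ = ⨆ θ : ℝ, ‖iteratedDeriv k φ θ‖ := rfl

/-- The usual Fréchet topology of `C^∞(∂D)`: uniform convergence of all derivatives. -/
instance : TopologicalSpace TestFun :=
  (SeminormFamily.moduleFilterBasis (𝕜 := ℂ) (fun k : ℕ => supSeminorm k)).topology

theorem withSeminorms : WithSeminorms (fun k : ℕ => supSeminorm k) := ⟨rfl⟩

/-- The complex conjugate of a test function. -/
def conjugate (φ : TestFun) : TestFun :=
  mk (fun θ => conj (φ θ)) (Complex.conjCLE.contDiff.comp φ.contDiff)
    (fun θ => congrArg conj (φ.periodic θ))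

theorem supSeminorm_conjugate (k : ℕ) (φ : TestFun) :
    supSeminorm k (conjugate φ) = supSeminorm k φ := by
  rw [supSeminorm_apply, supSeminorm_apply]
  refine iSup_congr fun θ => ?_
  rw [← norm_iteratedFDeriv_eq_norm_iteratedDeriv, ← norm_iteratedFDeriv_eq_norm_iteratedDeriv]
  exact Complex.conjLIE.norm_iteratedFDeriv_comp_left (φ : ℝ → ℂ) θ k

end TestFun

/-- The space `𝒟'(∂D)` of distributions on the circle: continuous linear functionals on
`C^∞(∂D)`. -/
abbrev Distribution : Type := TestFun →L[ℂ] ℂ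

/-- A linear functional dominated by finitely many seminorms is continuous; conversely every
distribution satisfies such a bound. -/
theorem continuous_iff_bound (L : TestFun →ₗ[ℂ] ℂ) :
    Continuous L ↔ ∃ (s : Finset ℕ) (C : NNReal), ∀ φ : TestFun,
      ‖L φ‖ ≤ C * (s.sup fun k : ℕ => TestFun.supSeminorm k) φ := by
  have := TestFun.withSeminorms.topologicalAddGroup
  constructor
  · intro h
    obtain ⟨s, C, -, hC⟩ := Seminorm.bound_of_continuous TestFun.withSeminorms
      ((normSeminorm ℂ ℂ).comp L) (continuous_norm.comp h)
    exact ⟨s, C, fun φ => hC φ⟩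
  · rintro ⟨s, C, hC⟩
    refine TestFun.withSeminorms.continuous_normedSpace_rng (F := ℂ) L ⟨s, C, ?_⟩
    intro φ
    exact hC φ

/-- The real part of a distribution, `⟨Re T, φ⟩ = (⟨T, φ⟩ + conj ⟨T, conj φ⟩) / 2`. -/
def rePart (T : Distribution) : Distribution where
  toFun := fun φ => (T φ + conj (T φ.conjugate)) / 2
  map_add' := by
    intro φ ψ
    have h : (φ + ψ).conjugate = φ.conjugate + ψ.conjugate :=
      TestFun.ext (fun θ => map_add conj (φ θ) (ψ θ))
    rw [h, map_add, map_add, map_add]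
    ring
  map_smul' := by
    intro c φ
    have h : (c • φ).conjugate = (conj c : ℂ) • φ.conjugate :=
      TestFun.ext (fun θ => map_mul conj c (φ θ))
    rw [h, map_smul, map_smul, smul_eq_mul, smul_eq_mul, map_mul, Complex.conj_conj,
      RingHom.id_apply, smul_eq_mul]
    ring
  cont := by
    have hconj : Continuous TestFun.conjugate := by
      have := TestFun.withSeminorms.topologicalAddGroup
      rw [continuous_iff_continuousAt]
      intro φ
      refine (TestFun.withSeminorms.tendsto_nhds _ _).2 fun k ε hε => ?_
      filter_upwards [(TestFun.withSeminorms.tendsto_nhds id φ).1 Filter.tendsto_id k ε hε]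
        with ψ hψ
      have h : ψ.conjugate - φ.conjugate = (ψ - φ).conjugate :=
        TestFun.ext (fun θ => (map_sub conj (ψ θ) (φ θ)).symm)
      rw [h, TestFun.supSeminorm_conjugate]
      exact hψ
    exact (T.continuous.add (Complex.continuous_conj.comp (T.continuous.comp hconj))).div_const 2

/-- On real-valued test functions, `Re T` is the real part of the value of `T`. -/
theorem rePart_apply_of_real (T : Distribution) (φ : TestFun) (h : ∀ θ, conj (φ θ) = φ θ) :
    rePart T φ = ((T φ).re : ℂ) := by
  have h' : φ.conjugate = φ := TestFun.ext h
  change (T φ + conj (T φ.conjugate)) / 2 = _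
  rw [h', Complex.add_conj]
  push_cast
  ring

/-! ### Holomorphic Hardy spaces and boundary values -/

/-- `‖w‖_{H^p(D)} = (sup_{0<r<1} (1/2π) ∫₀^{2π} |w(re^{iθ})|^p dθ)^{1/p}`, with values in
`[0, ∞]`. -/
def hardyNorm (p : ℝ) (w : ℂ → ℂ) : ℝ≥0∞ :=
  (⨆ r : Set.Ioo (0 : ℝ) 1, ENNReal.ofReal (1 / (2 * Real.pi)) *
    ∫⁻ θ in Set.Ioc 0 (2 * Real.pi), ‖w (r * Complex.exp (θ * Complex.I))‖ₑ ^ p) ^ (1 / p)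

/-- The holomorphic Hardy space `H^p(D)` of the unit disk. A function on the disk is represented
by a function on `ℂ`, whose values outside the disk play no role. -/
def hardySpace (p : ℝ) : Set (ℂ → ℂ) :=
  {w | DifferentiableOn ℂ w (Metric.ball 0 1) ∧ hardyNorm p w < ⊤}

/-- The distribution `T` is the boundary value in the sense of distributions of `f`. -/
def HasBoundaryValue (f : ℂ → ℂ) (T : Distribution) : Prop :=
  ∀ φ : TestFun, Filter.Tendsto
    (fun r : ℝ => ∫ θ in (0 : ℝ)..(2 * Real.pi), f (r * Complex.exp (θ * Complex.I)) * φ θ)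
    (𝓝[<] 1) (𝓝 (T φ))

/-- `Re (H^p(D))_b`: the real parts of boundary values in the sense of distributions of functions
in `H^p(D)`. -/
def reHardyBoundary (p : ℝ) : Set Distribution :=
  {h | ∃ H ∈ hardySpace p, ∃ T : Distribution, HasBoundaryValue H T ∧ rePart T = h}

/-! ### The real-variable Hardy space -/

/-- The Poisson kernel `P_r(θ) = (1 - r²) / (1 - 2 r cos θ + r²)`. -/
def poisson (r θ : ℝ) : ℝ := (1 - r ^ 2) / (1 - 2 * r * Real.cos θ + r ^ 2)

theorem poisson_denom_pos (r : Set.Ico (0 : ℝ) 1) (θ : ℝ) :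
    0 < 1 - 2 * (r : ℝ) * Real.cos θ + (r : ℝ) ^ 2 := by
  nlinarith [r.2.1, r.2.2, Real.cos_le_one θ, sq_nonneg (1 - (r : ℝ)),
    mul_nonneg r.2.1 (sub_nonneg.2 (Real.cos_le_one θ)), mul_pos (sub_pos.2 r.2.2)
    (sub_pos.2 r.2.2)]

/-- The test function `t ↦ P_r(θ - t)`, for `0 ≤ r < 1`. -/
def poissonTest (r : Set.Ico (0 : ℝ) 1) (θ : ℝ) : TestFun :=
  TestFun.mk (fun t => (poisson r (θ - t) : ℂ))
    (by
      have h : ContDiff ℝ ∞ fun t : ℝ => poisson r (θ - t) := by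
        refine ContDiff.div contDiff_const ?_ fun t => (poisson_denom_pos r (θ - t)).ne'
        fun_prop
      exact Complex.ofRealCLM.contDiff.comp h)
    (by
      intro t
      have h : Real.cos (θ - (t + 2 * Real.pi)) = Real.cos (θ - t) := by
        rw [← sub_sub, Real.cos_sub_two_pi]
      simp only [poisson, h])

/-- The radial maximal function `θ ↦ sup_{0≤r<1} |(1/2π) ⟨g, P_r(θ - ·)⟩|`, with values in
`[0, ∞]`. -/
def radialMaximal (g : Distribution) (θ : ℝ) : ℝ≥0∞ :=
  ⨆ r : Set.Ico (0 : ℝ) 1, ‖(1 / (2 * Real.pi) : ℂ) * g (poissonTest r θ)‖ₑ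

/-- The real-variable Hardy space `𝓗^p(D)` of distributions on the circle. -/
def realHardySpace (p : ℝ) : Set Distribution :=
  {g | ∫⁻ θ in Set.Ioc 0 (2 * Real.pi), radialMaximal g θ ^ p < ⊤}

end CircleHardy

end

noncomputable section

namespace CircleHardy

open MeasureTheory Filter Set

/-! ### The Poisson kernel -/

/-! Testing the boundary distribution of `H` against a Poisson kernel returns `2π H(re^{iθ})`
(`boundaryValue_poissonTest`), so the radial maximal function of its real part is at most `sup_r
|H(re^{iθ})|`. It remains to bound this supremum in `L^p` by the circle means of `|H|^p`.

Since `|H|^{p/2}` is subharmonic, it lies below the Poisson integral of its values on a larger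
circle (`norm_rpow_le_poisson_integral`). As `|H|^p` is the square of `|H|^{p/2}`, an `L²` maximal
inequality for Poisson integrals is enough.

That inequality is linearized: the radius becomes a measurable function `s(θ)`, giving an operator
`A` with kernel `P_{s(θ)}(θ - t)`. By the semigroup law `AA*` has kernel `2π P_{s(θ)s(φ)}(θ - φ)`,
which is at most `16π` times the sum of the kernels of `A` and `A*`. Hence `‖A‖² ≤ 32π ‖A‖`, so `‖A‖
≤ 32π` once `‖A‖` is finite, which holds when the radii stay away from `1`. The constant does not
depend on `s`, so radii that nearly attain the supremum may be chosen and monotone convergence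
concludes. -/

theorem poisson_nonneg {r : ℝ} (hr : r ∈ Ico (0 : ℝ) 1) (x : ℝ) : 0 ≤ poisson r x :=
  div_nonneg (by nlinarith [hr.1, hr.2]) (poisson_denom_pos ⟨r, hr⟩ x).le

theorem poisson_neg (r x : ℝ) : poisson r (-x) = poisson r x := by
  simp [poisson]

theorem continuous_poisson {r : ℝ} (hr : r ∈ Ico (0 : ℝ) 1) : Continuous (poisson r) :=
  Continuous.div (by fun_prop) (by fun_prop) fun x => (poisson_denom_pos ⟨r, hr⟩ x).ne'

theorem measurable_poisson : Measurable (Function.uncurry poisson) := by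
  unfold poisson Function.uncurry
  fun_prop

theorem poisson_le_of_le {r R : ℝ} (hr : 0 ≤ r) (hrR : r ≤ R) (hR : R < 1) (x : ℝ) :
    poisson r x ≤ 2 / (1 - R) := by
  have h1 : (0 : ℝ) < 1 - R := by linarith
  have hd := poisson_denom_pos ⟨r, hr, hrR.trans_lt hR⟩ x
  have hc := Real.cos_le_one x
  rw [poisson, div_le_div_iff₀ hd h1]
  have h2 : (1 - r) ^ 2 ≤ 1 - 2 * r * Real.cos x + r ^ 2 := by
    nlinarith [mul_nonneg hr (sub_nonneg.2 hc)]
  nlinarith [mul_nonneg (sub_nonneg.2 hrR) (sub_nonneg.2 (hrR.trans hR.le)),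
    mul_nonneg (sub_nonneg.2 hrR) hr, sq_nonneg (1 - r)]

/-- When `r ≤ s`, the distances `1 - rs` and `1 - r` to the boundary are comparable, because `r² ≤
rs ≤ r`. The factor `8` is `2` from the numerators times `4` from the denominators. -/
theorem poisson_mul_le_of_le {r s : ℝ} (hr : 0 ≤ r) (hrs : r ≤ s) (hs : s < 1) (x : ℝ) :
    poisson (r * s) x ≤ 8 * poisson r x := by
  have hr1 : r < 1 := hrs.trans_lt hs
  have hs0 : 0 ≤ s := hr.trans hrs
  have hq0 : 0 ≤ r * s := mul_nonneg hr hs0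
  have hqr : r * s ≤ r := mul_le_of_le_one_right hr hs.le
  have hd := poisson_denom_pos ⟨r, hr, hr1⟩ x
  have hd' := poisson_denom_pos ⟨r * s, hq0, hqr.trans_lt hr1⟩ x
  simp only at hd hd'
  have hc0 : 0 ≤ 1 - Real.cos x := sub_nonneg.2 (Real.cos_le_one x)
  have hc2 : 1 - Real.cos x ≤ 2 := by linarith [Real.neg_one_le_cos x]
  have hnum : 1 - (r * s) ^ 2 ≤ 2 * (1 - r ^ 2) := by nlinarith
  have hden : 1 - 2 * r * Real.cos x + r ^ 2
      ≤ 4 * (1 - 2 * (r * s) * Real.cos x + (r * s) ^ 2) := by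
    set c := 1 - Real.cos x with hc
    have hcos : Real.cos x = 1 - c := by rw [hc]; ring
    rw [hcos]
    have h1 : (1 - r) ^ 2 ≤ (1 - r * s) ^ 2 := by nlinarith
    -- With `c = 1 - cos x`, the denominator at radius `r` is `(1 - r)² + 2rc`. If `s ≥ 1/2` the two
    -- summands compare separately. Otherwise `r ≤ 1/2` and `rs ≤ 1/4`, so the left side is at most
    -- `(1 + r)² ≤ 9/4 ≤ 4(1 - rs)²`.
    rcases le_total (1 / 2) s with h | h
    · have h2 : r ≤ 2 * (r * s) := by nlinarith
      nlinarith [mul_le_mul_of_nonneg_right h2 hc0, mul_nonneg hq0 hc0, sq_nonneg (1 - r * s)]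
    · have h3 : r * s ≤ 1 / 4 := by nlinarith
      nlinarith [mul_le_mul_of_nonneg_left hc2 hr, mul_nonneg hq0 hc0]
  have hn0 : 0 ≤ 1 - r ^ 2 := by nlinarith
  rw [poisson, poisson, mul_div_assoc', div_le_div_iff₀ hd' hd]
  calc (1 - (r * s) ^ 2) * (1 - 2 * r * Real.cos x + r ^ 2)
      ≤ (2 * (1 - r ^ 2)) * (4 * (1 - 2 * (r * s) * Real.cos x + (r * s) ^ 2)) := by
        gcongr
    _ = _ := by ring

/-- Decouples the two radii: each term on the right depends on only one of them, which is what turns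
`AA*` into `A + A*`. -/
theorem poisson_mul_le {r s : ℝ} (hr : r ∈ Ico (0 : ℝ) 1) (hs : s ∈ Ico (0 : ℝ) 1) (x : ℝ) :
    poisson (r * s) x ≤ 8 * (poisson r x + poisson s x) := by
  have h1 := poisson_nonneg hr x
  have h2 := poisson_nonneg hs x
  rcases le_total r s with h | h
  · linarith [poisson_mul_le_of_le hr.1 h hs.2 x]
  · rw [mul_comm r s]
    linarith [poisson_mul_le_of_le hs.1 h hr.2 x]

/-! ### Poisson's formula and the semigroup law -/

theorem poisson_eq_re {r : ℝ} (x : ℝ) :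
    ((1 + r * Complex.exp (x * Complex.I)) / (1 - r * Complex.exp (x * Complex.I))).re
      = poisson r x := by
  rw [Complex.div_re, ← add_div, poisson]
  simp only [Complex.exp_ofReal_mul_I_re, Complex.exp_ofReal_mul_I_im, Complex.add_re,
    Complex.sub_re, Complex.add_im, Complex.sub_im, Complex.one_re, Complex.one_im,
    Complex.re_ofReal_mul, Complex.im_ofReal_mul, Complex.normSq_apply]
  congr 1
  · linear_combination (-(r ^ 2)) * Real.sin_sq_add_cos_sq x
  · linear_combination (r ^ 2) * Real.sin_sq_add_cos_sq x

theorem poisson_eq_poissonKernel (r θ t : ℝ) :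
    poissonKernel 0 (r * Complex.exp (θ * Complex.I)) (Complex.exp (t * Complex.I))
      = poisson r (θ - t) := by
  have h : Complex.exp (θ * Complex.I)
      = Complex.exp (t * Complex.I) * Complex.exp ((θ - t : ℝ) * Complex.I) := by
    rw [← Complex.exp_add]; push_cast; ring_nf
  have h0 := Complex.exp_ne_zero (t * Complex.I)
  rw [poissonKernel_eq_re_herglotzRieszKernel, Function.comp_apply, herglotzRieszKernel,
    ← poisson_eq_re]
  congr 1
  rw [h, sub_zero, sub_zero, ← mul_div_mul_left (1 + _) _ h0]
  ring_nf

theorem mul_exp_mem_ball {r : ℝ} (hr : r ∈ Ico (0 : ℝ) 1) (θ : ℝ) :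
    (r : ℂ) * Complex.exp (θ * Complex.I) ∈ Metric.ball (0 : ℂ) 1 := by
  simp [abs_of_nonneg hr.1, hr.2]

theorem poisson_integral {f : ℂ → ℂ} (hf : DiffContOnCl ℂ f (Metric.ball 0 1)) {r : ℝ}
    (hr : r ∈ Ico (0 : ℝ) 1) (θ : ℝ) :
    ∫ t in (0 : ℝ)..(2 * Real.pi), (poisson r (θ - t) : ℂ) * f (Complex.exp (t * Complex.I))
      = 2 * Real.pi * f (r * Complex.exp (θ * Complex.I)) := by
  have h := hf.circleAverage_poissonKernel_smul (mul_exp_mem_ball hr θ)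
  rw [Real.circleAverage_def] at h
  rw [← h]
  simp only [circleMap, zero_add, Complex.ofReal_one, one_mul, Pi.smul_apply',
    poisson_eq_poissonKernel, Complex.real_smul]
  rw [← Complex.ofReal_ofNat, ← Complex.ofReal_mul]
  push_cast
  rw [mul_inv_cancel_left₀ (by simp)]

theorem continuous_comp_exp {f : ℂ → ℂ} (hf : DiffContOnCl ℂ f (Metric.ball 0 1)) :
    Continuous fun t : ℝ => f (Complex.exp (t * Complex.I)) := by
  have h := hf.continuousOn
  rw [closure_ball _ one_ne_zero] at h
  exact h.comp_continuous (by fun_prop) fun t => by simp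

theorem poisson_integral_re {f : ℂ → ℂ} (hf : DiffContOnCl ℂ f (Metric.ball 0 1)) {r : ℝ}
    (hr : r ∈ Ico (0 : ℝ) 1) (θ : ℝ) :
    ∫ t in (0 : ℝ)..(2 * Real.pi), poisson r (θ - t) * (f (Complex.exp (t * Complex.I))).re
      = 2 * Real.pi * (f (r * Complex.exp (θ * Complex.I))).re := by
  have h := congrArg Complex.reCLM (poisson_integral hf hr θ)
  have hc : Continuous fun t : ℝ =>
      (poisson r (θ - t) : ℂ) * f (Complex.exp (t * Complex.I)) :=
    (Complex.continuous_ofReal.comp ((continuous_poisson hr).comp (by fun_prop))).mul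
      (continuous_comp_exp hf)
  rw [← Complex.reCLM.intervalIntegral_comp_comm (hc.intervalIntegrable _ _)] at h
  simpa [Complex.re_ofReal_mul, Complex.mul_re] using h

theorem integral_poisson {r : ℝ} (hr : r ∈ Ico (0 : ℝ) 1) (θ : ℝ) :
    ∫ t in (0 : ℝ)..(2 * Real.pi), poisson r (θ - t) = 2 * Real.pi := by
  simpa using poisson_integral_re (f := fun _ => 1) diffContOnCl_const hr θ

/-- The factor `P_s(φ - t)` is the boundary real part of `(1 + az)/(1 - az)` with `a = s e^{-iφ}`,
which is holomorphic near the closed disk since `|a| < 1`. Poisson's formula evaluates it at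
`re^{iθ}`. -/
theorem integral_poisson_mul_poisson {r s : ℝ} (hr : r ∈ Ico (0 : ℝ) 1)
    (hs : s ∈ Ico (0 : ℝ) 1) (θ φ : ℝ) :
    ∫ t in (0 : ℝ)..(2 * Real.pi), poisson r (θ - t) * poisson s (φ - t)
      = 2 * Real.pi * poisson (r * s) (θ - φ) := by
  set a : ℂ := s * Complex.exp (-φ * Complex.I) with ha
  have hna : ‖a‖ = s := by
    rw [ha, norm_mul, ← Complex.ofReal_neg, Complex.norm_exp_ofReal_mul_I]
    simp [abs_of_nonneg hs.1]
  have hf : DiffContOnCl ℂ (fun z => (1 + a * z) / (1 - a * z)) (Metric.ball 0 1) := by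
    apply DifferentiableOn.diffContOnCl
    rw [closure_ball _ one_ne_zero]
    apply DifferentiableOn.div (by fun_prop) (by fun_prop)
    intro z hz h0
    have h1 : a * z = 1 := (sub_eq_zero.1 h0).symm
    have h2 : ‖a‖ * ‖z‖ = 1 := by rw [← norm_mul, h1, norm_one]
    have h3 : ‖z‖ ≤ 1 := by simpa using hz
    rw [hna] at h2
    nlinarith [hs.1, hs.2, norm_nonneg z]
  have h := poisson_integral_re hf hr θ
  have e1 : ∀ t : ℝ, a * Complex.exp (t * Complex.I)
      = s * Complex.exp ((t - φ : ℝ) * Complex.I) := by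
    intro t
    rw [ha, mul_assoc, ← Complex.exp_add]; push_cast; ring_nf
  have e2 : a * (r * Complex.exp (θ * Complex.I))
      = (r * s : ℝ) * Complex.exp ((θ - φ : ℝ) * Complex.I) := by
    rw [mul_left_comm, e1]; push_cast; ring
  simp only [e1, e2, poisson_eq_re] at h
  rw [← h]
  congr 1
  ext t
  rw [← neg_sub t φ, poisson_neg]

/-! ### The maximal operator, linearized -/

/-- Lebesgue measure on one period. -/
def circleMeasure : Measure ℝ := volume.restrict (Ioc 0 (2 * Real.pi))

instance : IsFiniteMeasure circleMeasure :=
  ⟨by simp [circleMeasure, ENNReal.mul_lt_top]⟩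

/-- The Poisson kernel with values in `[0, ∞]`. -/
def poissonENN (r x : ℝ) : ℝ≥0∞ := ENNReal.ofReal (poisson r x)

@[fun_prop]
theorem Measurable.poissonENN {α : Type*} [MeasurableSpace α] {f g : α → ℝ} (hf : Measurable f)
    (hg : Measurable g) : Measurable fun a => poissonENN (f a) (g a) :=
  (measurable_poisson.comp (hf.prodMk hg)).ennreal_ofReal

theorem poissonENN_neg (r x : ℝ) : poissonENN r (-x) = poissonENN r x := by
  rw [poissonENN, poisson_neg, poissonENN]

theorem lintegral_poissonENN_mul {r : ℝ} (hr : r ∈ Ico (0 : ℝ) 1) (θ : ℝ) {g : ℝ → ℝ}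
    (hg : Continuous g) (hg0 : ∀ t, 0 ≤ g t) :
    ∫⁻ t, poissonENN r (θ - t) * ENNReal.ofReal (g t) ∂circleMeasure
      = ENNReal.ofReal (∫ t in (0 : ℝ)..(2 * Real.pi), poisson r (θ - t) * g t) := by
  have hc : Continuous fun t => poisson r (θ - t) * g t :=
    ((continuous_poisson hr).comp (by fun_prop)).mul hg
  rw [intervalIntegral.integral_of_le Real.two_pi_pos.le,
    ofReal_integral_eq_lintegral_ofReal (hc.integrableOn_Ioc)
      (ae_of_all _ fun t => mul_nonneg (poisson_nonneg hr _) (hg0 t))]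
  refine lintegral_congr fun t => ?_
  rw [ENNReal.ofReal_mul (poisson_nonneg hr _), poissonENN]

theorem lintegral_poissonENN_mul_poissonENN_le {r s : ℝ} (hr : r ∈ Ico (0 : ℝ) 1)
    (hs : s ∈ Ico (0 : ℝ) 1) (θ φ : ℝ) :
    ∫⁻ t, poissonENN r (θ - t) * poissonENN s (φ - t) ∂circleMeasure
      ≤ ENNReal.ofReal (16 * Real.pi) * (poissonENN r (θ - φ) + poissonENN s (θ - φ)) := by
  have h := lintegral_poissonENN_mul hr θ (g := fun t => poisson s (φ - t))
    ((continuous_poisson hs).comp (by fun_prop)) fun t => poisson_nonneg hs _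
  simp only [poissonENN] at h ⊢
  rw [h, integral_poisson_mul_poisson hr hs, ← ENNReal.ofReal_add (poisson_nonneg hr _)
    (poisson_nonneg hs _), ← ENNReal.ofReal_mul (by positivity)]
  apply ENNReal.ofReal_le_ofReal
  nlinarith [poisson_mul_le hr hs (θ - φ), Real.pi_pos]

theorem sq_lintegral_mul_le {α : Type*} [MeasurableSpace α] (μ : Measure α) {f g : α → ℝ≥0∞}
    (hf : Measurable f) (hg : Measurable g) :
    (∫⁻ a, f a * g a ∂μ) ^ 2 ≤ (∫⁻ a, f a ^ 2 ∂μ) * ∫⁻ a, g a ^ 2 ∂μ := by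
  have h := ENNReal.lintegral_mul_le_Lp_mul_Lq μ Real.HolderConjugate.two_two hf.aemeasurable
    hg.aemeasurable
  refine (pow_le_pow_left' h 2).trans ?_
  rw [mul_pow, ← ENNReal.rpow_natCast, ← ENNReal.rpow_mul, ← ENNReal.rpow_natCast,
    ← ENNReal.rpow_mul]
  simp

/-- Poisson integrals `θ ↦ ∫ P_{s(θ)}(θ - t) u(t) dt` with variable radius. -/
def poissonOp (s : ℝ → ℝ) (u : ℝ → ℝ≥0∞) (θ : ℝ) : ℝ≥0∞ :=
  ∫⁻ t, poissonENN (s θ) (θ - t) * u t ∂circleMeasure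

/-- The formal adjoint of `poissonOp`. -/
def poissonOpAdj (s : ℝ → ℝ) (g : ℝ → ℝ≥0∞) (t : ℝ) : ℝ≥0∞ :=
  ∫⁻ θ, poissonENN (s θ) (θ - t) * g θ ∂circleMeasure

section

variable {s : ℝ → ℝ} {u g : ℝ → ℝ≥0∞}

theorem measurable_poissonOp (hs : Measurable s) (hu : Measurable u) :
    Measurable (poissonOp s u) := by
  unfold poissonOp
  apply Measurable.lintegral_prod_right' (f := fun z : ℝ × ℝ =>
    poissonENN (s z.1) (z.1 - z.2) * u z.2)
  fun_prop

theorem measurable_poissonOpAdj (hs : Measurable s) (hg : Measurable g) :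
    Measurable (poissonOpAdj s g) := by
  unfold poissonOpAdj
  apply Measurable.lintegral_prod_right' (f := fun z : ℝ × ℝ =>
    poissonENN (s z.2) (z.2 - z.1) * g z.2)
  fun_prop

theorem lintegral_mul_poissonOp (hs : Measurable s) (hu : Measurable u) (hg : Measurable g) :
    ∫⁻ θ, g θ * poissonOp s u θ ∂circleMeasure
      = ∫⁻ t, u t * poissonOpAdj s g t ∂circleMeasure := by
  simp only [poissonOp, poissonOpAdj]
  have h1 : ∀ θ, g θ * ∫⁻ t, poissonENN (s θ) (θ - t) * u t ∂circleMeasure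
      = ∫⁻ t, g θ * (poissonENN (s θ) (θ - t) * u t) ∂circleMeasure := fun θ =>
    (lintegral_const_mul _ (by fun_prop)).symm
  have h2 : ∀ t, u t * ∫⁻ θ, poissonENN (s θ) (θ - t) * g θ ∂circleMeasure
      = ∫⁻ θ, u t * (poissonENN (s θ) (θ - t) * g θ) ∂circleMeasure := fun θ =>
    (lintegral_const_mul _ (by fun_prop)).symm
  simp only [h1, h2]
  rw [lintegral_lintegral_swap (by fun_prop)]
  refine lintegral_congr fun t => lintegral_congr fun θ => by ring

/-- This is `‖A*g‖² = ⟨g, AA*g⟩ ≤ 16π ⟨g, Ag + A*g⟩ = 32π ⟨g, Ag⟩`, using the pointwise kernel bound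
and, at the end, duality. -/
theorem lintegral_sq_poissonOpAdj_le (hs : Measurable s) (hs1 : ∀ θ, s θ ∈ Ico (0 : ℝ) 1)
    (hg : Measurable g) :
    ∫⁻ t, poissonOpAdj s g t ^ 2 ∂circleMeasure
      ≤ ENNReal.ofReal (32 * Real.pi) * ∫⁻ θ, g θ * poissonOp s g θ ∂circleMeasure := by
  have hadj := measurable_poissonOpAdj hs hg
  have key : ∀ θ, poissonOp s (poissonOpAdj s g) θ
      ≤ ENNReal.ofReal (16 * Real.pi) * (poissonOp s g θ + poissonOpAdj s g θ) := by
    intro θ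
    have h1 : poissonOp s (poissonOpAdj s g) θ = ∫⁻ φ, g φ * ∫⁻ t, poissonENN (s θ) (θ - t) *
        poissonENN (s φ) (φ - t) ∂circleMeasure ∂circleMeasure := by
      have h2 : ∀ t, poissonENN (s θ) (θ - t) * poissonOpAdj s g t = ∫⁻ φ,
          poissonENN (s θ) (θ - t) * (poissonENN (s φ) (φ - t) * g φ) ∂circleMeasure := fun t =>
        (lintegral_const_mul _ (by fun_prop)).symm
      have h3 : ∀ φ, g φ * ∫⁻ t, poissonENN (s θ) (θ - t) *
          poissonENN (s φ) (φ - t) ∂circleMeasure = ∫⁻ t, g φ * (poissonENN (s θ) (θ - t) *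
          poissonENN (s φ) (φ - t)) ∂circleMeasure := fun φ =>
        (lintegral_const_mul _ (by fun_prop)).symm
      rw [poissonOp]
      simp only [h2, h3]
      rw [lintegral_lintegral_swap (by fun_prop)]
      refine lintegral_congr fun φ => lintegral_congr fun t => by ring
    rw [h1, poissonOp, poissonOpAdj, ← lintegral_add_left (by fun_prop),
      ← lintegral_const_mul _ (by fun_prop)]
    refine lintegral_mono fun φ => ?_
    calc _ ≤ g φ * (ENNReal.ofReal (16 * Real.pi) *
          (poissonENN (s θ) (θ - φ) + poissonENN (s φ) (θ - φ))) := by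
          gcongr
          exact lintegral_poissonENN_mul_poissonENN_le (hs1 θ) (hs1 φ) θ φ
      _ = _ := by
          rw [← neg_sub φ θ, poissonENN_neg (s φ)]
          ring
  calc ∫⁻ t, poissonOpAdj s g t ^ 2 ∂circleMeasure
      = ∫⁻ θ, g θ * poissonOp s (poissonOpAdj s g) θ ∂circleMeasure := by
        rw [lintegral_mul_poissonOp hs hadj hg]
        simp only [sq]
    _ ≤ ∫⁻ θ, ENNReal.ofReal (16 * Real.pi) *
          (g θ * poissonOp s g θ + g θ * poissonOpAdj s g θ) ∂circleMeasure := by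
        refine lintegral_mono fun θ => ?_
        refine (mul_le_mul_right (key θ) (g θ)).trans_eq ?_
        ring
    _ = _ := by
        rw [lintegral_const_mul _ (by have := measurable_poissonOp hs hg; fun_prop),
          lintegral_add_left (by have := measurable_poissonOp hs hg; fun_prop),
          ← lintegral_mul_poissonOp hs hg hg, ← two_mul, ← mul_assoc, mul_comm _ (2 : ℝ≥0∞),
          ← ENNReal.ofReal_ofNat 2, ← ENNReal.ofReal_mul (by norm_num)]
        ring_nf

/-- A crude bound that blows up as `R → 1`; it only supplies the a priori finiteness needed to
absorb the norm of `A`. -/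
theorem lintegral_sq_poissonOp_le_of_le {R : ℝ} (hs0 : ∀ θ, 0 ≤ s θ)
    (hsR : ∀ θ, s θ ≤ R) (hR : R < 1) (hu : Measurable u) :
    ∫⁻ θ, poissonOp s u θ ^ 2 ∂circleMeasure
      ≤ (ENNReal.ofReal (2 / (1 - R)) ^ 2 * circleMeasure univ ^ 2)
        * ∫⁻ t, u t ^ 2 ∂circleMeasure := by
  have h : ∀ θ, poissonOp s u θ ^ 2 ≤ ENNReal.ofReal (2 / (1 - R)) ^ 2 * circleMeasure univ
      * ∫⁻ t, u t ^ 2 ∂circleMeasure := by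
    intro θ
    have h1 : poissonOp s u θ ≤ ENNReal.ofReal (2 / (1 - R)) * ∫⁻ t, 1 * u t ∂circleMeasure := by
      rw [← lintegral_const_mul _ (by fun_prop)]
      refine lintegral_mono fun t => ?_
      rw [one_mul]
      gcongr
      exact ENNReal.ofReal_le_ofReal (poisson_le_of_le (hs0 θ) (hsR θ) hR _)
    refine (pow_le_pow_left' h1 2).trans ?_
    rw [mul_pow, mul_assoc]
    gcongr
    simpa using sq_lintegral_mul_le circleMeasure measurable_one hu
  refine (lintegral_mono h).trans_eq ?_
  rw [lintegral_const]
  ring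

/-- Self-improvement: if `N` bounds `‖A‖²`, so does `32π √N`. Take `g = Au`, write `‖g‖² = ⟨u,
A*g⟩`, and apply Cauchy–Schwarz, the bound on `‖A*g‖²`, and Cauchy–Schwarz again with `‖Ag‖² ≤ N
‖g‖²`. -/
theorem sq_lintegral_sq_poissonOp_le {N : ℝ≥0∞} (hs : Measurable s)
    (hs1 : ∀ θ, s θ ∈ Ico (0 : ℝ) 1)
    (hN : ∀ v, Measurable v → ∫⁻ θ, poissonOp s v θ ^ 2 ∂circleMeasure
      ≤ N * ∫⁻ t, v t ^ 2 ∂circleMeasure)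
    (hu : Measurable u) (hfin : ∫⁻ θ, poissonOp s u θ ^ 2 ∂circleMeasure ≠ ⊤) :
    (∫⁻ θ, poissonOp s u θ ^ 2 ∂circleMeasure) ^ 2
      ≤ ENNReal.ofReal (32 * Real.pi) ^ 2 * N * (∫⁻ t, u t ^ 2 ∂circleMeasure) ^ 2 := by
  set X := ∫⁻ θ, poissonOp s u θ ^ 2 ∂circleMeasure with hX
  set U := ∫⁻ t, u t ^ 2 ∂circleMeasure
  set D := ENNReal.ofReal (32 * Real.pi)
  have hg := measurable_poissonOp hs hu
  set g := poissonOp s u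
  set Y := ∫⁻ t, poissonOpAdj s g t ^ 2 ∂circleMeasure
  set Z := ∫⁻ θ, g θ * poissonOp s g θ ∂circleMeasure
  have h1 : X ^ 2 ≤ U * Y := by
    have h : X = ∫⁻ t, u t * poissonOpAdj s g t ∂circleMeasure := by
      rw [← lintegral_mul_poissonOp hs hu hg, hX]
      simp only [sq, g]
    rw [h]
    exact sq_lintegral_mul_le _ hu (measurable_poissonOpAdj hs hg)
  have h2 : Y ≤ D * Z := lintegral_sq_poissonOpAdj_le hs hs1 hg
  have h3 : Z ^ 2 ≤ X * (N * X) :=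
    (sq_lintegral_mul_le _ hg (measurable_poissonOp hs hg)).trans
      (mul_le_mul_right (hN g hg) X)
  have h4 : X ^ 2 * X ^ 2 ≤ X ^ 2 * (D ^ 2 * N * U ^ 2) :=
    calc X ^ 2 * X ^ 2 = (X ^ 2) ^ 2 := by ring
      _ ≤ (U * (D * Z)) ^ 2 := by gcongr; exact h1.trans (by gcongr)
      _ = U ^ 2 * D ^ 2 * Z ^ 2 := by ring
      _ ≤ U ^ 2 * D ^ 2 * (X * (N * X)) := by gcongr
      _ = _ := by ring
  rcases eq_or_ne X 0 with h0 | h0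
  · simp [h0]
  · exact (ENNReal.mul_le_mul_iff_right (pow_ne_zero 2 h0) (ENNReal.pow_ne_top hfin)).1 h4

/-- The `L²` bound for Poisson integrals with variable radius. The constant does not depend on the
choice of the radii. -/
theorem lintegral_sq_poissonOp_le {R : ℝ} (hs : Measurable s) (hs0 : ∀ θ, 0 ≤ s θ)
    (hsR : ∀ θ, s θ ≤ R) (hR : R < 1) (hu : Measurable u) :
    ∫⁻ θ, poissonOp s u θ ^ 2 ∂circleMeasure
      ≤ ENNReal.ofReal (32 * Real.pi) ^ 2 * ∫⁻ t, u t ^ 2 ∂circleMeasure := by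
  have hs1 : ∀ θ, s θ ∈ Ico (0 : ℝ) 1 := fun θ => ⟨hs0 θ, (hsR θ).trans_lt hR⟩
  set D : NNReal := (32 * Real.pi).toNNReal
  have hD : 0 < D := Real.toNNReal_pos.2 (by positivity)
  -- Admissible values of `‖A‖²`. Restricting to `v` of finite norm makes each condition closed in
  -- `N`, as multiplication by a finite constant is continuous on `[0, ∞]`; the infimum is then
  -- admissible.
  let S : Set NNReal := {N | ∀ v, Measurable v → ∫⁻ t, v t ^ 2 ∂circleMeasure ≠ ⊤ →
    ∫⁻ θ, poissonOp s v θ ^ 2 ∂circleMeasure ≤ N * ∫⁻ t, v t ^ 2 ∂circleMeasure}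
  have hfin : (ENNReal.ofReal (2 / (1 - R)) ^ 2 * circleMeasure univ ^ 2) ≠ ⊤ :=
    ENNReal.mul_ne_top (ENNReal.pow_ne_top ENNReal.ofReal_ne_top)
      (ENNReal.pow_ne_top (measure_ne_top _ _))
  have hne : S.Nonempty := by
    refine ⟨(ENNReal.ofReal (2 / (1 - R)) ^ 2 * circleMeasure univ ^ 2).toNNReal, ?_⟩
    intro v hv _
    rw [ENNReal.coe_toNNReal hfin]
    exact lintegral_sq_poissonOp_le_of_le hs0 hsR hR hv
  have hcl : IsClosed S := by
    simp only [S, Set.ofPred_forall]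
    refine isClosed_iInter fun v => isClosed_iInter fun _ => isClosed_iInter fun h => ?_
    exact isClosed_le continuous_const
      ((ENNReal.continuous_mul_const h).comp ENNReal.continuous_coe)
  have hmem : sInf S ∈ S := hcl.csInf_mem hne (OrderBot.bddBelow S)
  have hstep : ∀ N ∈ S, 0 < N → D * NNReal.sqrt N ∈ S := by
    intro N hN hN0 v hv hvt
    have hN' : ∀ v, Measurable v → ∫⁻ θ, poissonOp s v θ ^ 2 ∂circleMeasure
        ≤ N * ∫⁻ t, v t ^ 2 ∂circleMeasure := by
      intro v hv
      by_cases h : ∫⁻ t, v t ^ 2 ∂circleMeasure = ⊤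
      · rw [h, ENNReal.mul_top (by simpa using hN0.ne')]; exact le_top
      · exact hN v hv h
    have h := sq_lintegral_sq_poissonOp_le hs hs1 hN' hv
      ((hN' v hv).trans_lt (ENNReal.mul_lt_top ENNReal.coe_lt_top hvt.lt_top)).ne
    refine (ENNReal.pow_le_pow_left_iff two_ne_zero).1 (h.trans_eq ?_)
    rw [mul_pow, ← ENNReal.coe_pow, mul_pow D, NNReal.sq_sqrt, ENNReal.coe_mul, ENNReal.coe_pow]
    rfl
  -- The least admissible `N` satisfies `N ≤ D √N`, hence `N ≤ D²`.
  have hle : sInf S ≤ D ^ 2 := by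
    rcases eq_or_lt_of_le (zero_le (a := sInf S)) with h0 | h0
    · rw [← h0]; exact zero_le
    · have h1 : sInf S ≤ D * NNReal.sqrt (sInf S) :=
        csInf_le (OrderBot.bddBelow S) (hstep _ hmem h0)
      have h2 : NNReal.sqrt (sInf S) * NNReal.sqrt (sInf S) = sInf S := NNReal.mul_self_sqrt _
      have h3 : 0 < NNReal.sqrt (sInf S) := NNReal.sqrt_pos.2 h0
      have h4 : NNReal.sqrt (sInf S) ≤ D := by
        refine le_of_mul_le_mul_right ?_ h3
        rwa [h2]
      rw [← h2, sq]
      gcongr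
  by_cases h : ∫⁻ t, u t ^ 2 ∂circleMeasure = ⊤
  · rw [h, ENNReal.mul_top]
    · exact le_top
    · exact pow_ne_zero 2 (ENNReal.coe_ne_zero.2 hD.ne')
  · refine (hmem u hu h).trans ?_
    have h5 : ((sInf S : NNReal) : ℝ≥0∞) ≤ ((D ^ 2 : NNReal) : ℝ≥0∞) := ENNReal.coe_le_coe.2 hle
    rw [ENNReal.coe_pow] at h5
    exact mul_le_mul_left h5 _

end

/-! ### Subharmonicity of powers -/

theorem exists_polynomial_re_eq_of_mem_span [Fact (0 < 2 * Real.pi)]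
    {g : C(AddCircle (2 * Real.pi), ℂ)}
    (hg : g ∈ Submodule.span ℂ (range (@fourier (2 * Real.pi)))) :
    ∃ Q : Polynomial ℂ, ∀ t : ℝ,
      (Q.eval (Complex.exp (t * Complex.I))).re = (g (t : AddCircle (2 * Real.pi))).re := by
  -- Taking real parts is not complex linear, so the induction carries an arbitrary factor `c`.
  -- Negative frequencies are reflected by `Re(c e^{-imt}) = Re(c̄ e^{imt})`.
  suffices h : ∀ c : ℂ, ∃ Q : Polynomial ℂ, ∀ t : ℝ,
      (Q.eval (Complex.exp (t * Complex.I))).re = (c * g (t : AddCircle (2 * Real.pi))).re by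
    simpa using h 1
  induction hg using Submodule.span_induction with
  | mem x hx =>
    obtain ⟨n, rfl⟩ := hx
    intro c
    have hn : ∀ t : ℝ, fourier n (t : AddCircle (2 * Real.pi))
        = Complex.exp (t * Complex.I) ^ n := by
      intro t
      rw [fourier_coe_apply, ← Complex.exp_int_mul]
      congr 1
      push_cast
      have : (Real.pi : ℂ) ≠ 0 := by exact_mod_cast Real.pi_ne_zero
      field_simp
    rcases Int.eq_nat_or_neg n with ⟨m, rfl | rfl⟩
    · exact ⟨Polynomial.C c * Polynomial.X ^ m, fun t => by simp [hn]⟩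
    · refine ⟨Polynomial.C (conj c) * Polynomial.X ^ m, fun t => ?_⟩
      have h : Complex.exp (t * Complex.I) ^ (-(m : ℤ))
          = conj (Complex.exp (t * Complex.I) ^ m) := by
        rw [zpow_neg, zpow_natCast, ← inv_pow, map_pow, ← Complex.exp_neg, ← Complex.exp_conj]
        simp
      rw [hn, h, ← Complex.conj_re]
      simp
  | zero => exact fun c => ⟨0, by simp⟩
  | add x y _ _ hx hy =>
    intro c
    obtain ⟨P, hP⟩ := hx c
    obtain ⟨Q, hQ⟩ := hy c
    exact ⟨P + Q, fun t => by simp [hP, hQ, mul_add]⟩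
  | smul a x _ hx =>
    intro c
    obtain ⟨P, hP⟩ := hx (c * a)
    exact ⟨P, fun t => by rw [hP]; simp [mul_assoc]⟩

/-- Continuous real functions on the circle are uniform limits of real parts of polynomials. -/
theorem exists_polynomial_abs_re_sub_lt {g : ℝ → ℝ} (hg : Continuous g)
    (hper : Function.Periodic g (2 * Real.pi)) {δ : ℝ} (hδ : 0 < δ) :
    ∃ Q : Polynomial ℂ, ∀ t : ℝ, |(Q.eval (Complex.exp (t * Complex.I))).re - g t| < δ := by
  have : Fact (0 < 2 * Real.pi) := ⟨Real.two_pi_pos⟩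
  let G : C(AddCircle (2 * Real.pi), ℂ) :=
    ⟨fun x => (hper.lift x : ℂ), by
      refine Complex.continuous_ofReal.comp ?_
      exact continuous_coinduced_dom.2 hg⟩
  have hG : G ∈ closure (Submodule.span ℂ (range (@fourier (2 * Real.pi))) : Set _) := by
    rw [← Submodule.topologicalClosure_coe, span_fourier_closure_eq_top]
    trivial
  obtain ⟨h, hh, hd⟩ := Metric.mem_closure_iff.1 hG δ hδ
  obtain ⟨Q, hQ⟩ := exists_polynomial_re_eq_of_mem_span hh
  refine ⟨Q, fun t => ?_⟩
  rw [dist_eq_norm] at hd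
  have h1 := ((h - G).norm_coe_le_norm (t : AddCircle (2 * Real.pi))).trans_lt
    (by rwa [norm_sub_rev] at hd)
  have h2 := (Complex.abs_re_le_norm _).trans_lt h1
  rwa [ContinuousMap.sub_apply, Complex.sub_re, ← hQ] at h2

theorem continuous_norm_rpow {f : ℂ → ℂ} (hf : DiffContOnCl ℂ f (Metric.ball 0 1)) {q : ℝ}
    (hq : 0 < q) : Continuous fun t : ℝ => ‖f (Complex.exp (t * Complex.I))‖ ^ q :=
  (continuous_comp_exp hf).norm.rpow_const fun _ => Or.inr hq.le

/-- The sub-mean value property of `‖f‖ ^ q` with respect to the Poisson kernel. -/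
theorem norm_rpow_le_poisson_integral {f : ℂ → ℂ} (hf : DiffContOnCl ℂ f (Metric.ball 0 1))
    {q : ℝ} (hq : 0 < q) {r : ℝ} (hr : r ∈ Ico (0 : ℝ) 1) (θ : ℝ) :
    2 * Real.pi * ‖f (r * Complex.exp (θ * Complex.I))‖ ^ q
      ≤ ∫ t in (0 : ℝ)..(2 * Real.pi),
        poisson r (θ - t) * ‖f (Complex.exp (t * Complex.I))‖ ^ q := by
  set z : ℂ := r * Complex.exp (θ * Complex.I) with hz
  have hzb : z ∈ Metric.ball (0 : ℂ) 1 := mul_exp_mem_ball hr θ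
  have hPc : Continuous fun t : ℝ => poisson r (θ - t) :=
    (continuous_poisson hr).comp (by fun_prop)
  have hvc := continuous_norm_rpow hf hq
  set J := ∫ t in (0 : ℝ)..(2 * Real.pi),
        poisson r (θ - t) * ‖f (Complex.exp (t * Complex.I))‖ ^ q with hJ
  have key : ∀ ε : ℝ, 0 < ε →
      -- Adding `ε` to `|f|^q` makes its logarithm continuous despite zeros of `f`. A polynomial `Q`
      -- whose real part approximates this logarithm from above then provides the zero-free majorant
      -- `|e^Q|`.
      2 * Real.pi * ‖f z‖ ^ q ≤ Real.exp (2 * ε) * (J + 2 * Real.pi * ε) := by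
    intro ε hε
    set v : ℝ → ℝ := fun t => ‖f (Complex.exp (t * Complex.I))‖ ^ q + ε with hv
    have hv0 : ∀ t, 0 < v t := fun t => by positivity
    have hvcont : Continuous v := hvc.add continuous_const
    obtain ⟨Q₀, hQ₀⟩ := exists_polynomial_abs_re_sub_lt (g := fun t => Real.log (v t))
      (hvcont.log fun t => (hv0 t).ne')
      (fun t => by
        have : Complex.exp (((t + 2 * Real.pi : ℝ) : ℂ) * Complex.I)
            = Complex.exp (t * Complex.I) := by
          push_cast; rw [add_mul, Complex.exp_add, Complex.exp_two_pi_mul_I, mul_one]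
        simp only [hv, this]) hε
    -- The shift by `ε` turns the two-sided error into `log v ≤ Re Q ≤ log v + 2ε` on the circle.
    set Q : Polynomial ℂ := Q₀ + Polynomial.C (ε : ℂ)
    have hQ1 : ∀ t : ℝ, v t ≤ Real.exp (Q.eval (Complex.exp (t * Complex.I))).re := by
      intro t
      rw [← Real.log_le_iff_le_exp (hv0 t)]
      simp only [Q, Polynomial.eval_add, Polynomial.eval_C, Complex.add_re, Complex.ofReal_re]
      linarith [(abs_lt.1 (hQ₀ t)).1]
    have hQ2 : ∀ t : ℝ, Real.exp (Q.eval (Complex.exp (t * Complex.I))).re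
        ≤ Real.exp (2 * ε) * v t := by
      intro t
      rw [← Real.exp_log (hv0 t), ← Real.exp_add, Real.exp_le_exp]
      simp only [Q, Polynomial.eval_add, Polynomial.eval_C, Complex.add_re, Complex.ofReal_re]
      linarith [(abs_lt.1 (hQ₀ t)).2]
    have hdE : ∀ c : ℂ, Differentiable ℂ fun w => Complex.exp (c * Q.eval w) := fun c => by
      have := Q.differentiable
      fun_prop
    -- Maximum principle for `f e^{-Q/q}`, whose modulus is at most `1` on the circle because `|f|^q
    -- ≤ v ≤ e^{Re Q}` there.
    have hmax : ‖f z * Complex.exp (-(q⁻¹ : ℝ) * Q.eval z)‖ ≤ 1 := by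
      refine Complex.norm_le_of_forall_mem_frontier_norm_le (U := Metric.ball 0 1)
        (f := fun w => f w * Complex.exp (-(q⁻¹ : ℝ) * Q.eval w)) Metric.isBounded_ball
        (hf.smul (hdE _).diffContOnCl) ?_ (subset_closure hzb)
      intro w hw
      rw [frontier_ball _ one_ne_zero, mem_sphere_zero_iff_norm] at hw
      obtain ⟨t, rfl⟩ : ∃ t : ℝ, Complex.exp (t * Complex.I) = w :=
        ⟨w.arg, by simpa [hw] using Complex.norm_mul_exp_arg_mul_I w⟩
      rw [norm_mul, Complex.norm_exp, ← Complex.ofReal_neg, Complex.re_ofReal_mul, neg_mul,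
        Real.exp_neg, ← div_eq_mul_inv, div_le_one (Real.exp_pos _), ← Real.rpow_le_rpow_iff
        (norm_nonneg _) (Real.exp_pos _).le hq, ← Real.exp_mul, mul_comm _ q, ← mul_assoc,
        mul_inv_cancel₀ hq.ne', one_mul]
      refine le_trans ?_ (hQ1 t)
      simp only [hv]
      linarith
    have hfz : ‖f z‖ ^ q ≤ Real.exp (Q.eval z).re := by
      rw [norm_mul, Complex.norm_exp, ← Complex.ofReal_neg, Complex.re_ofReal_mul, neg_mul,
        Real.exp_neg, ← div_eq_mul_inv, div_le_one (Real.exp_pos _), ← Real.rpow_le_rpow_iff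
        (norm_nonneg _) (Real.exp_pos _).le hq, ← Real.exp_mul, mul_comm _ q, ← mul_assoc,
        mul_inv_cancel₀ hq.ne', one_mul] at hmax
      exact hmax
    have hE := poisson_integral (f := fun w => Complex.exp (1 * Q.eval w))
      (hdE 1).diffContOnCl hr θ
    have hE' : 2 * Real.pi * Real.exp (Q.eval z).re ≤ ∫ t in (0 : ℝ)..(2 * Real.pi),
        poisson r (θ - t) * Real.exp (Q.eval (Complex.exp (t * Complex.I))).re := by
      have h1 : 2 * Real.pi * Real.exp (Q.eval z).re
          = ‖2 * (Real.pi : ℂ) * Complex.exp (1 * Q.eval z)‖ := by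
        rw [norm_mul, Complex.norm_exp, one_mul]
        simp [abs_of_pos Real.pi_pos]
      rw [h1, hz, ← hE]
      refine (intervalIntegral.norm_integral_le_integral_norm Real.two_pi_pos.le).trans_eq ?_
      congr 1
      ext t
      rw [norm_mul, Complex.norm_exp, one_mul, Complex.norm_real, Real.norm_eq_abs,
        abs_of_nonneg (poisson_nonneg hr _)]
    have hEc : Continuous fun t : ℝ => Real.exp (Q.eval (Complex.exp (t * Complex.I))).re :=
      Real.continuous_exp.comp (Complex.continuous_re.comp (Q.continuous.comp (by fun_prop)))
    calc 2 * Real.pi * ‖f z‖ ^ q ≤ 2 * Real.pi * Real.exp (Q.eval z).re := by gcongr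
      _ ≤ _ := hE'
      _ ≤ ∫ t in (0 : ℝ)..(2 * Real.pi), Real.exp (2 * ε) * (poisson r (θ - t) *
            ‖f (Complex.exp (t * Complex.I))‖ ^ q + poisson r (θ - t) * ε) := by
        refine intervalIntegral.integral_mono_on Real.two_pi_pos.le
          ((hPc.mul hEc).intervalIntegrable _ _)
          ((continuous_const.mul ((hPc.mul hvc).add (hPc.mul continuous_const))).intervalIntegrable
            _ _) fun t _ => ?_
        refine (mul_le_mul_of_nonneg_left (hQ2 t) (poisson_nonneg hr _)).trans_eq ?_
        simp only [hv]
        ring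
      _ = _ := by
        have hi1 : IntervalIntegrable (fun t => poisson r (θ - t) *
            ‖f (Complex.exp (t * Complex.I))‖ ^ q) volume 0 (2 * Real.pi) :=
          (hPc.mul hvc).intervalIntegrable _ _
        have hi2 : IntervalIntegrable (fun t => poisson r (θ - t) * ε) volume 0 (2 * Real.pi) :=
          (hPc.mul continuous_const).intervalIntegrable _ _
        rw [intervalIntegral.integral_const_mul, intervalIntegral.integral_add hi1 hi2,
          intervalIntegral.integral_mul_const, integral_poisson hr]
  have hlim : Tendsto (fun ε : ℝ => Real.exp (2 * ε) * (J + 2 * Real.pi * ε)) (𝓝[>] 0) (𝓝 J) := by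
    have : Continuous fun ε : ℝ => Real.exp (2 * ε) * (J + 2 * Real.pi * ε) := by fun_prop
    simpa using (this.tendsto 0).mono_left nhdsWithin_le_nhds
  exact ge_of_tendsto hlim (eventually_nhdsWithin_of_forall key)

theorem enorm_rpow_le_lintegral {f : ℂ → ℂ} (hf : DiffContOnCl ℂ f (Metric.ball 0 1))
    {q : ℝ} (hq : 0 < q) {r : ℝ} (hr : r ∈ Ico (0 : ℝ) 1) (θ : ℝ) :
    ENNReal.ofReal (2 * Real.pi) * ‖f (r * Complex.exp (θ * Complex.I))‖ₑ ^ q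
      ≤ ∫⁻ t, poissonENN r (θ - t) * ‖f (Complex.exp (t * Complex.I))‖ₑ ^ q ∂circleMeasure := by
  have h := lintegral_poissonENN_mul hr θ (continuous_norm_rpow hf hq) fun t => by positivity
  simp only [← ofReal_norm, ENNReal.ofReal_rpow_of_nonneg (norm_nonneg _) hq.le]
  rw [h, ← ENNReal.ofReal_mul (by positivity)]
  exact ENNReal.ofReal_le_ofReal (norm_rpow_le_poisson_integral hf hq hr θ)

/-! ### The radial maximal theorem for holomorphic functions -/

/-- The `p`-th power mean over circles, as in the definition of the Hardy norm. -/
def hardyMean (p : ℝ) (H : ℂ → ℂ) : ℝ≥0∞ :=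
  ⨆ r : Ioo (0 : ℝ) 1, ∫⁻ θ, ‖H (r * Complex.exp (θ * Complex.I))‖ₑ ^ p ∂circleMeasure

theorem hardyMean_lt_top {p : ℝ} (hp : 0 < p) {H : ℂ → ℂ} (hH : hardyNorm p H < ⊤) :
    hardyMean p H < ⊤ := by
  rw [hardyNorm, ENNReal.rpow_lt_top_iff_of_pos (by positivity), ← ENNReal.mul_iSup] at hH
  refine (ENNReal.mul_lt_top_iff.1 hH).elim (fun h => h.2) fun h => ?_
  rcases h with h | h
  · exact absurd h (ENNReal.ofReal_pos.2 (by positivity)).ne'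
  · rw [hardyMean, circleMeasure, h]; exact ENNReal.zero_lt_top

/-- The maximal bound for one measurable choice of radii. `R` enters the hypotheses but not the
constant, so it may later tend to `1`. -/
theorem lintegral_enorm_rpow_le {p : ℝ} (hp : 0 < p) {H : ℂ → ℂ}
    (hH : DifferentiableOn ℂ H (Metric.ball 0 1)) {s : ℝ → ℝ} (hs : Measurable s) {R : ℝ}
    (hs0 : ∀ θ, 0 ≤ s θ) (hsR : ∀ θ, s θ ≤ R) (hR : R < 1) :
    ENNReal.ofReal (2 * Real.pi) ^ 2
        * ∫⁻ θ, ‖H (s θ * Complex.exp (θ * Complex.I))‖ₑ ^ p ∂circleMeasure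
      ≤ ENNReal.ofReal (32 * Real.pi) ^ 2 * hardyMean p H := by
  have hR0 : 0 ≤ R := (hs0 0).trans (hsR 0)
  -- A circle strictly between `R` and `1`: the dilate `H(ρz)` is continuous up to the boundary, and
  -- the rescaled radii `s/ρ` still stay below `R/ρ < 1`.
  set ρ : ℝ := (1 + R) / 2 with hρ
  have hρ0 : 0 < ρ := by positivity
  have hρ1 : ρ < 1 := by linarith
  have hRρ : R < ρ := by linarith
  have hf : DiffContOnCl ℂ (fun z => H (ρ * z)) (Metric.ball 0 1) := by
    apply DifferentiableOn.diffContOnCl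
    rw [closure_ball _ one_ne_zero]
    refine hH.comp (by fun_prop) fun z hz => ?_
    have hz' : ‖z‖ ≤ 1 := by simpa using hz
    rw [mem_ball_zero_iff, norm_mul, Complex.norm_real, Real.norm_eq_abs, abs_of_pos hρ0]
    nlinarith
  have hR' : R / ρ < 1 := (div_lt_one hρ0).2 hRρ
  have hs0' : ∀ θ, 0 ≤ s θ / ρ := fun θ => div_nonneg (hs0 θ) hρ0.le
  have hsR' : ∀ θ, s θ / ρ ≤ R / ρ := fun θ => div_le_div_of_nonneg_right (hsR θ) hρ0.le
  set u : ℝ → ℝ≥0∞ := fun t => ‖H (ρ * Complex.exp (t * Complex.I))‖ₑ ^ (p / 2) with hu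
  have hum : Measurable u :=
    (continuous_comp_exp hf).enorm.measurable.pow_const _
  have hsq : ∀ x : ℝ≥0∞, (x ^ (p / 2)) ^ 2 = x ^ p := fun x => by
    rw [← ENNReal.rpow_natCast, ← ENNReal.rpow_mul]; norm_num
  have hpt : ∀ θ, ENNReal.ofReal (2 * Real.pi)
      * ‖H (s θ * Complex.exp (θ * Complex.I))‖ₑ ^ (p / 2)
      ≤ poissonOp (fun θ => s θ / ρ) u θ := by
    intro θ
    have h := enorm_rpow_le_lintegral hf (q := p / 2) (by positivity)
      ⟨hs0' θ, (hsR' θ).trans_lt hR'⟩ θ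
    have e : (ρ : ℂ) * ((s θ / ρ : ℝ) * Complex.exp (θ * Complex.I))
        = s θ * Complex.exp (θ * Complex.I) := by
      have : (ρ : ℂ) ≠ 0 := by exact_mod_cast hρ0.ne'
      push_cast
      field_simp
    rw [e] at h
    exact h
  calc ENNReal.ofReal (2 * Real.pi) ^ 2
        * ∫⁻ θ, ‖H (s θ * Complex.exp (θ * Complex.I))‖ₑ ^ p ∂circleMeasure
      = ∫⁻ θ, (ENNReal.ofReal (2 * Real.pi)
          * ‖H (s θ * Complex.exp (θ * Complex.I))‖ₑ ^ (p / 2)) ^ 2 ∂circleMeasure := by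
        rw [← lintegral_const_mul' _ _ (ENNReal.pow_ne_top ENNReal.ofReal_ne_top)]
        simp only [mul_pow, hsq]
    _ ≤ ∫⁻ θ, poissonOp (fun θ => s θ / ρ) u θ ^ 2 ∂circleMeasure :=
        lintegral_mono fun θ => pow_le_pow_left' (hpt θ) 2
    _ ≤ ENNReal.ofReal (32 * Real.pi) ^ 2 * ∫⁻ t, u t ^ 2 ∂circleMeasure :=
        lintegral_sq_poissonOp_le (by fun_prop) hs0' hsR' hR' hum
    _ ≤ _ := by
        gcongr
        simp only [hu, hsq]
        exact le_iSup (fun r : Ioo (0 : ℝ) 1 =>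
          ∫⁻ θ, ‖H (r * Complex.exp (θ * Complex.I))‖ₑ ^ p ∂circleMeasure) ⟨ρ, hρ0, hρ1⟩

/-- Among the first `n + 1` radii `r k`, one at which `F` is maximal on the ray at angle `θ`. -/
def bestRadius (F : ℝ → ℝ → ℝ≥0∞) (r : ℕ → ℝ) : ℕ → ℝ → ℝ
  | 0 => fun _ => r 0
  | n + 1 => fun θ =>
    if F (bestRadius F r n θ) θ ≤ F (r (n + 1)) θ then r (n + 1) else bestRadius F r n θ

theorem measurable_bestRadius {F : ℝ → ℝ → ℝ≥0∞} (hF : Measurable (Function.uncurry F))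
    (r : ℕ → ℝ) (n : ℕ) : Measurable (bestRadius F r n) := by
  induction n with
  | zero => exact measurable_const
  | succ n ih =>
    exact Measurable.ite (measurableSet_le (hF.comp (ih.prodMk measurable_id))
      (hF.comp (measurable_const.prodMk measurable_id))) measurable_const ih

theorem bestRadius_mem (F : ℝ → ℝ → ℝ≥0∞) (r : ℕ → ℝ) (n : ℕ) (θ : ℝ) :
    ∃ k ≤ n, bestRadius F r n θ = r k := by
  induction n with
  | zero => exact ⟨0, le_rfl, rfl⟩
  | succ n ih =>
    simp only [bestRadius]
    split_ifs
    · exact ⟨n + 1, le_rfl, rfl⟩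
    · obtain ⟨k, hk, h⟩ := ih
      exact ⟨k, hk.trans n.le_succ, h⟩

theorem monotone_bestRadius (F : ℝ → ℝ → ℝ≥0∞) (r : ℕ → ℝ) (θ : ℝ) :
    Monotone fun n => F (bestRadius F r n θ) θ := by
  refine monotone_nat_of_le_succ fun n => ?_
  simp only [bestRadius]
  split_ifs with h
  · exact h
  · exact le_rfl

theorem le_bestRadius (F : ℝ → ℝ → ℝ≥0∞) (r : ℕ → ℝ) (n : ℕ) (θ : ℝ) :
    F (r n) θ ≤ F (bestRadius F r n θ) θ := by
  cases n with
  | zero => exact le_rfl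
  | succ n =>
    simp only [bestRadius]
    split_ifs with h
    · exact le_rfl
    · exact (not_le.1 h).le

/-- By continuity along rays, a dense sequence of radii gives the whole supremum. Maximizing over
its first `n + 1` terms is a measurable choice, and the maxima increase with `n`. -/
theorem lintegral_iSup_enorm_rpow_le {p : ℝ} (hp : 0 < p) {H : ℂ → ℂ}
    (hH : DifferentiableOn ℂ H (Metric.ball 0 1)) :
    ENNReal.ofReal (2 * Real.pi) ^ 2
        * ∫⁻ θ, (⨆ r : Ico (0 : ℝ) 1, ‖H (r * Complex.exp (θ * Complex.I))‖ₑ) ^ p ∂circleMeasure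
      ≤ ENNReal.ofReal (32 * Real.pi) ^ 2 * hardyMean p H := by
  have : Nonempty (Ico (0 : ℝ) 1) := ⟨⟨0, by simp⟩⟩
  set r : ℕ → ℝ := fun n => (TopologicalSpace.denseSeq (Ico (0 : ℝ) 1) n : ℝ) with hr
  have hr1 : ∀ n, r n ∈ Ico (0 : ℝ) 1 := fun n => (TopologicalSpace.denseSeq (Ico (0 : ℝ) 1) n).2
  -- `H` is arbitrary outside the disk; cutting it off there makes `F` jointly measurable.
  set F : ℝ → ℝ → ℝ≥0∞ := fun ρ θ =>
    ‖(Metric.ball (0 : ℂ) 1).indicator H (ρ * Complex.exp (θ * Complex.I))‖ₑ with hF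
  have hFeq : ∀ ρ ∈ Ico (0 : ℝ) 1, ∀ θ, F ρ θ = ‖H (ρ * Complex.exp (θ * Complex.I))‖ₑ :=
    fun ρ hρ θ => by rw [hF]; simp only [indicator_of_mem (mul_exp_mem_ball hρ θ)]
  have hHm : Measurable ((Metric.ball (0 : ℂ) 1).indicator H) := by
    classical
    rw [← piecewise_eq_indicator]
    exact hH.continuousOn.measurable_piecewise continuousOn_const Metric.isOpen_ball.measurableSet
  have hFm : Measurable (Function.uncurry F) := by
    have : Measurable fun z : ℝ × ℝ => (z.1 : ℂ) * Complex.exp (z.2 * Complex.I) := by fun_prop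
    exact (hHm.comp this).enorm
  have hbest : ∀ n θ, bestRadius F r n θ ∈ Ico (0 : ℝ) 1 := fun n θ => by
    obtain ⟨k, -, h⟩ := bestRadius_mem F r n θ
    rw [h]; exact hr1 k
  have hsup : ∀ θ : ℝ, ⨆ ρ : Ico (0 : ℝ) 1, ‖H (ρ * Complex.exp (θ * Complex.I))‖ₑ
      ≤ ⨆ n, F (bestRadius F r n θ) θ := by
    intro θ
    have hc : Continuous fun ρ : Ico (0 : ℝ) 1 => ‖H (ρ * Complex.exp (θ * Complex.I))‖ₑ :=
      (hH.continuousOn.comp_continuous (by fun_prop)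
        fun ρ => mul_exp_mem_ball ρ.2 θ).enorm
    have hcl : IsClosed {ρ : Ico (0 : ℝ) 1 | ‖H (ρ * Complex.exp (θ * Complex.I))‖ₑ
        ≤ ⨆ n, F (bestRadius F r n θ) θ} := isClosed_le hc continuous_const
    refine iSup_le fun ρ => ?_
    have hall := (TopologicalSpace.denseRange_denseSeq (Ico (0 : ℝ) 1)).closure_range
    have hsub : range (TopologicalSpace.denseSeq (Ico (0 : ℝ) 1)) ⊆
        {ρ : Ico (0 : ℝ) 1 | ‖H (ρ * Complex.exp (θ * Complex.I))‖ₑ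
          ≤ ⨆ n, F (bestRadius F r n θ) θ} := by
      rintro _ ⟨n, rfl⟩
      have h := (le_bestRadius F r n θ).trans
        (le_iSup (fun n => F (bestRadius F r n θ) θ) n)
      rwa [hFeq _ (hr1 n)] at h
    have := closure_minimal hsub hcl
    rw [hall] at this
    exact this (mem_univ ρ)
  have hbound : ∀ n, ENNReal.ofReal (2 * Real.pi) ^ 2
      * ∫⁻ θ, F (bestRadius F r n θ) θ ^ p ∂circleMeasure
      ≤ ENNReal.ofReal (32 * Real.pi) ^ 2 * hardyMean p H := by
    intro n
    -- Only finitely many radii occur at stage `n`, so the largest serves as the bound `R < 1`.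
    obtain ⟨k, hk, hmax⟩ := (Finset.range (n + 1)).exists_max_image r ⟨0, by simp⟩
    have h := lintegral_enorm_rpow_le hp hH (measurable_bestRadius hFm r n)
      (R := r k) (fun θ => (hbest n θ).1) (fun θ => by
        obtain ⟨j, hj, e⟩ := bestRadius_mem F r n θ
        rw [e]
        exact hmax j (Finset.mem_range.2 (Nat.lt_succ_of_le hj))) (hr1 k).2
    simpa only [hFeq _ (hbest n _)] using h
  calc _ ≤ ENNReal.ofReal (2 * Real.pi) ^ 2
        * ∫⁻ θ, ⨆ n, F (bestRadius F r n θ) θ ^ p ∂circleMeasure := by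
        gcongr with θ
        refine (ENNReal.rpow_le_rpow (hsup θ) hp.le).trans_eq ?_
        exact (ENNReal.orderIsoRpow p hp).map_iSup _
    _ = ⨆ n, ENNReal.ofReal (2 * Real.pi) ^ 2
        * ∫⁻ θ, F (bestRadius F r n θ) θ ^ p ∂circleMeasure := by
        rw [lintegral_iSup, ENNReal.mul_iSup]
        · exact fun n => (hFm.comp
            ((measurable_bestRadius hFm r n).prodMk measurable_id)).pow_const _
        · exact fun i j hij θ => ENNReal.rpow_le_rpow (monotone_bestRadius F r θ hij) hp.le
    _ ≤ _ := iSup_le hbound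

/-! ### Boundary values -/

/-- For `0 < ρ < 1`, Poisson's formula for the dilate `H(ρ·)` evaluates the approximating integral
as `2π H(ρz)` with `z = re^{iθ}`; let `ρ → 1`. -/
theorem boundaryValue_poissonTest {H : ℂ → ℂ} (hH : DifferentiableOn ℂ H (Metric.ball 0 1))
    {T : Distribution} (hT : HasBoundaryValue H T) (r : Ico (0 : ℝ) 1) (θ : ℝ) :
    T (poissonTest r θ) = 2 * Real.pi * H (r * Complex.exp (θ * Complex.I)) := by
  refine tendsto_nhds_unique (hT (poissonTest r θ)) ?_
  set z : ℂ := (r : ℝ) * Complex.exp (θ * Complex.I) with hz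
  have hzb : z ∈ Metric.ball (0 : ℂ) 1 := mul_exp_mem_ball r.2 θ
  have hlim : Tendsto (fun ρ : ℝ => 2 * (Real.pi : ℂ) * H (ρ * z)) (𝓝[<] 1)
      (𝓝 (2 * Real.pi * H z)) := by
    have h1 : ContinuousAt H ((1 : ℝ) * z) := by
      rw [Complex.ofReal_one, one_mul]
      exact (hH.differentiableAt (Metric.isOpen_ball.mem_nhds hzb)).continuousAt
    have h2 : ContinuousAt (fun ρ : ℝ => H (ρ * z)) 1 :=
      ContinuousAt.comp (f := fun ρ : ℝ => (ρ : ℂ) * z) h1 (by fun_prop)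
    have h3 := (h2.tendsto.const_mul (2 * (Real.pi : ℂ))).mono_left
      (nhdsWithin_le_nhds (s := Iio 1))
    simpa using h3
  refine hlim.congr' ?_
  filter_upwards [Ioo_mem_nhdsLT zero_lt_one] with ρ hρ
  have hf : DiffContOnCl ℂ (fun w => H (ρ * w)) (Metric.ball 0 1) := by
    apply DifferentiableOn.diffContOnCl
    rw [closure_ball _ one_ne_zero]
    refine hH.comp (by fun_prop) fun w hw => ?_
    have hw' : ‖w‖ ≤ 1 := by simpa using hw
    rw [mem_ball_zero_iff, norm_mul, Complex.norm_real, Real.norm_eq_abs, abs_of_pos hρ.1]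
    nlinarith [hρ.1, hρ.2]
  rw [← poisson_integral hf r.2 θ]
  congr 1
  ext t
  rw [mul_comm]
  rfl

theorem radialMaximal_rePart_le {H : ℂ → ℂ} (hH : DifferentiableOn ℂ H (Metric.ball 0 1))
    {T : Distribution} (hT : HasBoundaryValue H T) (θ : ℝ) :
    radialMaximal (rePart T) θ
      ≤ ⨆ r : Ico (0 : ℝ) 1, ‖H (r * Complex.exp (θ * Complex.I))‖ₑ := by
  refine iSup_mono fun r => ?_
  rw [rePart_apply_of_real T (poissonTest r θ) fun t => Complex.conj_ofReal _,
    boundaryValue_poissonTest hH hT]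
  set w := H (r * Complex.exp (θ * Complex.I))
  have h1 : (2 * (Real.pi : ℂ) * w).re = 2 * Real.pi * w.re := by
    rw [← Complex.ofReal_ofNat, ← Complex.ofReal_mul, Complex.re_ofReal_mul]
  have h2 : (1 / (2 * Real.pi) : ℂ) * ((2 * (Real.pi : ℂ) * w).re : ℂ) = (w.re : ℂ) := by
    have : (Real.pi : ℂ) ≠ 0 := by exact_mod_cast Real.pi_ne_zero
    rw [h1]
    push_cast
    field_simp
  rw [h2, enorm_le_iff_norm_le, Complex.norm_real]
  exact Complex.abs_re_le_norm w

end CircleHardy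

end

/-! ### The inclusion of Hardy spaces -/

theorem mainTheorem12 (p : ℝ) (hp0 : 0 < p) (hp1 : p ≤ 1) :
    CircleHardy.reHardyBoundary p ⊆ CircleHardy.realHardySpace p := by
  rintro _ ⟨H, ⟨hH, hfin⟩, T, hT, rfl⟩
  have hbound := CircleHardy.lintegral_iSup_enorm_rpow_le hp0 hH
  have htop := hbound.trans_lt (ENNReal.mul_lt_top (ENNReal.pow_lt_top ENNReal.ofReal_lt_top)
    (CircleHardy.hardyMean_lt_top hp0 hfin))
  have hpos : ENNReal.ofReal (2 * Real.pi) ^ 2 ≠ 0 :=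
    pow_ne_zero 2 (ENNReal.ofReal_pos.2 Real.two_pi_pos).ne'
  refine lt_of_le_of_lt (MeasureTheory.lintegral_mono fun θ => ENNReal.rpow_le_rpow
    (CircleHardy.radialMaximal_rePart_le hH hT θ) hp0.le)
    (ENNReal.lt_top_of_mul_ne_top_right htop.ne hpos)
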